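/- Let $k\ge 3$ be an integer, $b_3,\dots,b_k$ and $a_{ij}$ $(2\le i+j\le k)$ real numbers with $a_{02}>0$, and let $f_0$ be the Whitney umbrella normal form $$f_0(u,v)=\Bigl(u,\;uv+\sum_{i=3}^k\frac{b_i}{i!}v^i+R_2(u,v),\;\sum_{j=2}^k\sum_{i=0}^j\frac{a_{i,j-i}}{i!\,(j-i)!}u^iv^{j-i}+R_3(u,v)\Bigr),$$ where $R_2,R_3$ are $C^\infty$ functions on an open neighbourhood $W$ of the origin in $\mathbb R^2$ all of whose derivatives of order $\le k$ vanish at the origin. Let $n=\dfrac{(f_0)_u\times (f_0)_v}{|(f_0)_u\times (f_0)_v|}$ be the unit normal away from the origin. For $r\ne0$ put $h(\theta)=f_0(r\cos\theta,r\sin\theta)$, and let $$\kappa_g(r,\theta)=\Bigl\langle \frac{(h_{\theta\theta})^{\tan}}{|h_\theta|^2},\; n\times\frac{h_\theta}{|h_\theta|}\Bigr\rangle$$ be the geodesic curvature of this curve on the surface $f_0$, where $n$ is evaluated at $(r\cos\theta,r\sin\theta)$ and $(h_{\theta\theta})^{\tan}=h_{\theta\theta}-\langle n,h_{\theta\theta}\rangle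 n$ is the component of $h_{\theta\theta}$ tangent to the surface. Put $$\mathcal A(\theta)=\sqrt{\cos^2\theta+(a_{11}\cos\theta+a_{02}\sin\theta)^2},$$ $$g(s)=(a_{11}^2+1)s^4+a_{11}a_{02}s^3+3(a_{11}^2+1)s^2+a_{11}(4a_{02}-a_{20})s+a_{02}(a_{02}-a_{20}).$$ Then there is $\varepsilon>0$ such that the following hold. 1. For $0<|r|<\varepsilon$ and every $\theta$, the point $(r\cos\theta,r\sin\theta)$ lies in $W$ and $f_0$ is an immersion there, and $h_\theta(\theta)\ne0$ if $\sin\theta\neq0$; so $\kappa_g(r,\theta)$ is defined whenever $0<|r|<\varepsilon$ and $\sin\theta\ne0$. 2. $\kappa_g$ extends to a $C^\infty$ function of $(r,\theta)$ on $\{(r,\theta):|r|<\varepsilon,\ \sin\theta\ne0\}$, whose value at $r=0$ is $\dfrac{|\sin\theta|}{\mathcal A(\theta)}\,g(\cot\theta)$. 3. For $\sin\theta\ne0$, $$\kappa_g(r,\theta)=\frac{|\sin\theta|}{\mathcal A(\theta)}\,g\!\left(\frac{\cos\theta}{\sin\theta}\right)+O(r),$$ where the error is at most $C|r|$ for all $0<|r|<\varepsilon$,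 with $C$ uniform for $\theta$ in any given compact subset of $\{\sin\theta\ne0\}$. -/

import Mathlib

open scoped ContDiff

noncomputable section

namespace WhitneyUmbrella

/-- Euclidean three-space. -/
abbrev E3 : Type := EuclideanSpace ℝ (Fin 3)

/-- The vector product of Euclidean three-space. -/
def cross (x y : E3) : E3 := WithLp.toLp 2 (crossProduct x.ofLp y.ofLp)

/-- `R` is a function germ at the origin of the plane of order at least `m`:
all its derivatives of order less than `m` vanish there. -/
def HasOrderGE (R : ℝ × ℝ → ℝ) (m : ℕ) : Prop :=
  ∀ i < m, iteratedFDeriv ℝ i R 0 = 0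

/-- The polynomial `B(v) = ∑_{i=3}^k b_i v^i / i!`. -/
def B (k : ℕ) (b : ℕ → ℝ) (v : ℝ) : ℝ :=
  ∑ i ∈ Finset.Icc 3 k, b i / (Nat.factorial i : ℝ) * v ^ i

/-- The form `A_j(u,v) = ∑_{i=0}^j a_{i,j-i} u^i v^(j-i) / (i! (j-i)!)`. -/
def A (a : ℕ → ℕ → ℝ) (j : ℕ) (u v : ℝ) : ℝ :=
  ∑ i ∈ Finset.range (j + 1),
    a i (j - i) / ((Nat.factorial i : ℝ) * (Nat.factorial (j - i) : ℝ)) * u ^ i * v ^ (j - i)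

/-- The normal form of a Whitney umbrella
`(u, v) ↦ (u, u v + B(v) + R₂(u,v), ∑_{j=2}^k A_j(u,v) + R₃(u,v))` with remainders `R₂`, `R₃`. -/
def normalForm (k : ℕ) (b : ℕ → ℝ) (a : ℕ → ℕ → ℝ) (R₂ R₃ : ℝ × ℝ → ℝ) (p : ℝ × ℝ) : E3 :=
  !₂[p.1,
     p.1 * p.2 + B k b p.2 + R₂ p,
     (∑ j ∈ Finset.Icc 2 k, A a j p.1 p.2) + R₃ p]

/-- `f_u × f_v` for a parametrized surface `f`. -/
def normalVector (f : ℝ × ℝ → E3) (p : ℝ × ℝ) : E3 :=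
  cross (fderiv ℝ f p (1, 0)) (fderiv ℝ f p (0, 1))

/-- The unit normal vector `f_u × f_v / |f_u × f_v|` (meaningful where `f` is an immersion). -/
def unitNormal (f : ℝ × ℝ → E3) (p : ℝ × ℝ) : E3 :=
  ‖normalVector f p‖⁻¹ • normalVector f p

/-- The covariant acceleration along `f` of the curve `f ∘ γ`: the component of the second
derivative of `f ∘ γ` tangent to the surface `f`. -/
def covariantAcceleration (f : ℝ × ℝ → E3) (γ : ℝ → ℝ × ℝ) (t : ℝ) : E3 :=
  deriv (deriv (f ∘ γ)) t
    - inner ℝ (unitNormal f (γ t)) (deriv (deriv (f ∘ γ)) t) • unitNormal f (γ t)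

/-- The geodesic curvature vector: the covariant acceleration divided by the squared speed.
(It differs from the covariant derivative of the unit tangent with respect to arc length by
a multiple of the tangent vector, which does not affect `geodesicCurvature`.) -/
def geodesicCurvatureVector (f : ℝ × ℝ → E3) (γ : ℝ → ℝ × ℝ) (t : ℝ) : E3 :=
  (‖deriv (f ∘ γ) t‖ ^ 2)⁻¹ • covariantAcceleration f γ t

/-- The geodesic curvature on the surface `f` of the curve `f ∘ γ`: the inner product of the
geodesic curvature vector with `n × e`, where `n` is the unit normal of `f` and
`e` the unit tangent of the curve. -/
def geodesicCurvature (f : ℝ × ℝ → E3) (γ : ℝ → ℝ × ℝ) (t : ℝ) : ℝ :=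
  inner ℝ (geodesicCurvatureVector f γ t)
    (cross (unitNormal f (γ t)) (‖deriv (f ∘ γ) t‖⁻¹ • deriv (f ∘ γ) t))

/-- The circle `γ(θ) = (r cos θ, r sin θ)`. -/
def circle (r θ : ℝ) : ℝ × ℝ := (r * Real.cos θ, r * Real.sin θ)

/-- `κ_g(r, θ)`: the geodesic curvature at `θ` of the image under `f` of the circle with
constant `r`. -/
def kappaG (f : ℝ × ℝ → E3) (r θ : ℝ) : ℝ := geodesicCurvature f (circle r) θ

/-- `𝒜(θ) = √(cos² θ + (a₁₁ cos θ + a₀₂ sin θ)²)`. -/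
def calA (a₁₁ a₀₂ θ : ℝ) : ℝ :=
  Real.sqrt (Real.cos θ ^ 2 + (a₁₁ * Real.cos θ + a₀₂ * Real.sin θ) ^ 2)

/-- The quartic `g(s)`. -/
def g (a₂₀ a₁₁ a₀₂ s : ℝ) : ℝ :=
  (a₁₁ ^ 2 + 1) * s ^ 4 + a₁₁ * a₀₂ * s ^ 3 + 3 * (a₁₁ ^ 2 + 1) * s ^ 2
    + a₁₁ * (4 * a₀₂ - a₂₀) * s + a₀₂ * (a₀₂ - a₂₀)

/-- The leading term `(|sin θ| / 𝒜(θ)) g(cos θ / sin θ)`. -/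
def leadingTerm (a₂₀ a₁₁ a₀₂ θ : ℝ) : ℝ :=
  |Real.sin θ| / calA a₁₁ a₀₂ θ * g a₂₀ a₁₁ a₀₂ (Real.cos θ / Real.sin θ)

end WhitneyUmbrella

end

/-!
In polar coordinates the normal form is `f(r cos θ, r sin θ) = r • diag(1, r, r) p(r, θ)` with `p`
smooth up to `r = 0`: by Taylor's formula every term of order at least `m` is `r ^ m` times a smooth
function of `(r, θ)`. The derivatives of `f` along the circle carry the same factor
`r • diag(1, r, r)`, and `diag(1, r, r) x × diag(1, r, r) y = r • diag(r, 1, 1) (x × y)`. Hence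
`f_u × f_v` is `r` times a smooth vector that does not vanish at `r = 0`, and all powers of `r`
cancel in `κ_g = ⟨f_u × f_v, f_θ × f_θθ⟩ / (|f_u × f_v| |f_θ|³)`. What remains is smooth up to
`r = 0`, where its value involves only the quadratic part of `f`, and the error estimate is the mean
value inequality in `r`.
-/

noncomputable section

namespace WhitneyUmbrella

open scoped Topology

section Analysis

variable {E G : Type*} [NormedAddCommGroup E] [NormedSpace ℝ E]
  [NormedAddCommGroup G] [NormedSpace ℝ G]

theorem hasFDerivAt_intervalIntegral_of_contDiff {F : E × ℝ → G} (hF : ContDiff ℝ 1 F)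
    (a b : ℝ) (x₀ : E) :
    HasFDerivAt (fun x ↦ ∫ t in a..b, F (x, t))
      (∫ t in a..b, (fderiv ℝ F (x₀, t)).comp (.inl ℝ E ℝ)) x₀ := by
  set F' : E × ℝ → E →L[ℝ] G := fun q ↦ (fderiv ℝ F q).comp (.inl ℝ E ℝ)
  have hF' : Continuous F' := (hF.continuous_fderiv one_ne_zero).clm_comp continuous_const
  have hF_slice (x : E) : Continuous fun t ↦ F (x, t) := hF.continuous.comp (by fun_prop)
  have hF'_slice : Continuous fun t ↦ F' (x₀, t) := hF'.comp (by fun_prop)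
  obtain ⟨C, hC⟩ := isCompact_uIcc.exists_bound_of_continuousOn (hF'_slice.continuousOn
    (s := Set.uIcc a b))
  have hbound : ∀ᶠ x in 𝓝 x₀, ∀ t ∈ Set.uIcc a b, ‖F' (x, t)‖ < C + 1 :=
    isCompact_uIcc.eventually_forall_of_forall_eventually fun t ht ↦
      hF'.norm.continuousAt.eventually_lt continuousAt_const ((hC t ht).trans_lt (lt_add_one C))
  refine intervalIntegral.hasFDerivAt_integral_of_dominated_of_fderiv_le
    (F := fun x t ↦ F (x, t)) (F' := fun x t ↦ F' (x, t)) (bound := fun _ ↦ C + 1) hbound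
    (.of_forall fun x ↦ (hF_slice x).aestronglyMeasurable) ((hF_slice x₀).intervalIntegrable _ _)
    hF'_slice.aestronglyMeasurable
    (.of_forall fun t ht x hx ↦ (hx t (Set.uIoc_subset_uIcc ht)).le) intervalIntegrable_const
    (.of_forall fun t _ x _ ↦ ?_)
  exact (hF.differentiable one_ne_zero (x, t)).hasFDerivAt.comp x (hasFDerivAt_prodMk_left x t)

theorem contDiff_multilinear_apply_const {n : WithTop ℕ∞} (m : ℕ) :
    ContDiff ℝ n fun q : (E [×m]→L[ℝ] G) × E ↦ q.1 fun _ ↦ q.2 := by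
  have h := (ContinuousLinearMap.id ℝ (E [×m]→L[ℝ] G)).cpolynomialOn_uncurry_of_multilinear
    (s := Set.univ)
  exact (contDiffOn_univ.1 (h.analyticOnNhd.analyticOn.contDiffOn uniqueDiffOn_univ)).comp
    (contDiff_fst.prodMk (contDiff_pi.2 fun _ ↦ contDiff_snd))

theorem exists_contDiff_eventuallyEq [HasContDiffBump E] {φ : E → G} {W : Set E} {x : E}
    (hW : W ∈ 𝓝 x) (hφ : ∀ y ∈ W, ContDiffAt ℝ ∞ φ y) :
    ∃ ψ : E → G, ContDiff ℝ ∞ ψ ∧ ψ =ᶠ[𝓝 x] φ := by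
  obtain ⟨δ, hδ, hδW⟩ := Metric.nhds_basis_closedBall.mem_iff.1 hW
  let χ : ContDiffBump x := ⟨δ / 2, δ, half_pos hδ, half_lt_self hδ⟩
  refine ⟨fun y ↦ χ y • φ y, contDiff_iff_contDiffAt.2 fun y ↦ ?_, ?_⟩
  · by_cases hy : y ∈ tsupport fun y ↦ χ y • φ y
    · have hyδ : y ∈ Metric.closedBall x δ :=
        closure_minimal (χ.support_eq.subset.trans Metric.ball_subset_closedBall)
          Metric.isClosed_closedBall (tsupport_smul_subset_left χ φ hy)
      exact χ.contDiffAt.smul (hφ y (hδW hyδ))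
    · exact contDiffAt_const.congr_of_eventuallyEq (notMem_tsupport_iff_eventuallyEq.1 hy)
  · filter_upwards [χ.eventuallyEq_one] with y hy
    simp only [hy, Pi.one_apply, one_smul]

end Analysis

section Remainder

universe u

-- A single universe, since the induction on the order replaces `G` by `E →L[ℝ] G`.
variable {E G : Type u} [NormedAddCommGroup E] [NormedSpace ℝ E]
  [NormedAddCommGroup G] [NormedSpace ℝ G]

theorem contDiff_intervalIntegral {n : ℕ∞} {F : E × ℝ → G} (hF : ContDiff ℝ n F) (a b : ℝ) :
    ContDiff ℝ n fun x ↦ ∫ t in a..b, F (x, t) := by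
  refine contDiff_iff_forall_nat_le.2 fun m hm ↦ ?_
  replace hF : ContDiff ℝ m F := hF.of_le (mod_cast hm)
  clear hm
  induction m generalizing G with
  | zero =>
    exact contDiff_zero.2 (intervalIntegral.continuous_parametric_intervalIntegral_of_continuous'
      (f := fun x t ↦ F (x, t)) hF.continuous a b)
  | succ m ih =>
    have hF' : ContDiff ℝ m fun q ↦ (fderiv ℝ F q).comp (.inl ℝ E ℝ) :=
      (hF.fderiv_right le_rfl).clm_comp contDiff_const
    exact contDiff_succ_iff_hasFDerivAt.2 ⟨_, ih hF',
      hasFDerivAt_intervalIntegral_of_contDiff (hF.of_le (by simp)) a b⟩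

theorem exists_contDiff_smul_eq_pow_smul [CompleteSpace G] {φ : E → G} (hφ : ContDiff ℝ ∞ φ)
    {m : ℕ} (h0 : ∀ i < m, iteratedFDeriv ℝ i φ 0 = 0) :
    ∃ ψ : ℝ × E → G, ContDiff ℝ ∞ ψ ∧ ∀ (r : ℝ) (x : E), φ (r • x) = r ^ m • ψ (r, x) := by
  rcases m with _ | m
  · exact ⟨fun q ↦ φ (q.1 • q.2), hφ.comp (contDiff_fst.smul contDiff_snd), by simp⟩
  -- `ψ` is the integral remainder of Taylor's formula for `φ (r • x)`, divided by `r ^ (m + 1)`.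
  let D := iteratedFDeriv ℝ (m + 1) φ
  have hD : ContDiff ℝ ∞ D := hφ.iteratedFDeriv_right (by norm_cast)
  have hF : ContDiff ℝ (⊤ : ℕ∞) fun p : (ℝ × E) × ℝ ↦
      (1 - p.2) ^ m • D ((p.2 * p.1.1) • p.1.2) fun _ ↦ p.1.2 :=
    ContDiff.smul (by fun_prop) ((contDiff_multilinear_apply_const (m + 1)).comp
      ((hD.comp (by fun_prop)).prodMk (by fun_prop)))
  refine ⟨_, (contDiff_intervalIntegral hF 0 1).const_smul (m.factorial : ℝ)⁻¹, fun r x ↦ ?_⟩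
  have taylor := map_add_eq_sum_add_integral_iteratedFDeriv (f := φ) (x := 0) (y := r • x)
    (n := m) fun t _ ↦ (hφ.of_le (mod_cast le_top)).contDiffAt
  rw [Finset.sum_eq_zero fun k hk ↦ by simp [h0 k (Finset.mem_range.1 hk)]] at taylor
  simp only [zero_add, ContinuousMultilinearMap.map_smul_univ, Finset.prod_const,
    Finset.card_univ, Fintype.card_fin, smul_comm _ (r ^ (m + 1)),
    intervalIntegral.integral_smul] at taylor
  simp only [taylor, D, smul_smul]

end Remainder

section PolarCoordinates

theorem circle_eq_smul (r θ : ℝ) : circle r θ = r • circle 1 θ := by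
  simp [circle]

theorem contDiff_circle {n : WithTop ℕ∞} : ContDiff ℝ n fun q : ℝ × ℝ ↦ circle q.1 q.2 := by
  unfold circle
  fun_prop

theorem norm_circle_le (r θ : ℝ) : ‖circle r θ‖ ≤ |r| := by
  refine max_le ?_ ?_ <;> simp only [circle, Real.norm_eq_abs, abs_mul]
  · exact mul_le_of_le_one_right (abs_nonneg r) (Real.abs_cos_le_one θ)
  · exact mul_le_of_le_one_right (abs_nonneg r) (Real.abs_sin_le_one θ)

theorem eventually_forall_circle {P : ℝ × ℝ → Prop} (h : ∀ᶠ x in 𝓝 0, P x) :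
    ∀ᶠ r in 𝓝 0, ∀ θ, P (circle r θ) := by
  obtain ⟨δ, hδ, h⟩ := Metric.eventually_nhds_iff.1 h
  filter_upwards [Metric.ball_mem_nhds 0 hδ] with r hr θ
  exact h (by simpa using (norm_circle_le r θ).trans_lt (by simpa using hr))

/-- `F` is divisible by `r ^ m` in polar coordinates, with a smooth quotient. -/
def PolarDivisible (m : ℕ) (F : ℝ × ℝ → ℝ) : Prop :=
  ∃ ψ : ℝ × ℝ → ℝ, ContDiff ℝ ∞ ψ ∧ ∀ᶠ r in 𝓝 0, ∀ θ, F (circle r θ) = r ^ m * ψ (r, θ)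

theorem PolarDivisible.add {m : ℕ} {F₁ F₂ : ℝ × ℝ → ℝ} (h₁ : PolarDivisible m F₁)
    (h₂ : PolarDivisible m F₂) : PolarDivisible m (F₁ + F₂) := by
  obtain ⟨ψ₁, hψ₁, h₁⟩ := h₁
  obtain ⟨ψ₂, hψ₂, h₂⟩ := h₂
  refine ⟨ψ₁ + ψ₂, hψ₁.add hψ₂, ?_⟩
  filter_upwards [h₁, h₂] with r h₁ h₂ θ
  simp only [Pi.add_apply, h₁, h₂, mul_add]

theorem PolarDivisible.sum {ι : Type*} {m : ℕ} {F : ι → ℝ × ℝ → ℝ} {s : Finset ι}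
    (h : ∀ i ∈ s, PolarDivisible m (F i)) : PolarDivisible m (∑ i ∈ s, F i) :=
  Finset.sum_induction F (PolarDivisible m) (fun _ _ ↦ .add)
    ⟨0, contDiff_const, by simp⟩ h

theorem PolarDivisible.of_homogeneous {m n : ℕ} {F : ℝ × ℝ → ℝ} (hmn : m ≤ n)
    (hF : ContDiff ℝ ∞ F) (hom : ∀ (r : ℝ) x, F (r • x) = r ^ n * F x) : PolarDivisible m F := by
  refine ⟨fun q ↦ q.1 ^ (n - m) * F (circle 1 q.2), ?_, .of_forall fun r θ ↦ ?_⟩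
  · exact (contDiff_fst.pow _).mul
      (hF.comp (contDiff_circle.comp (contDiff_const.prodMk contDiff_snd)))
  · rw [circle_eq_smul, hom, ← mul_assoc, ← pow_add, Nat.add_sub_cancel' hmn]

theorem HasOrderGE.polarDivisible {m : ℕ} {R : ℝ × ℝ → ℝ} {W : Set (ℝ × ℝ)}
    (hO : HasOrderGE R m) (hW : W ∈ 𝓝 0) (hR : ∀ x ∈ W, ContDiffAt ℝ ∞ R x) :
    PolarDivisible m R := by
  obtain ⟨S, hS, hSR⟩ := exists_contDiff_eventuallyEq hW hR
  obtain ⟨ψ, hψ, hψS⟩ := exists_contDiff_smul_eq_pow_smul hS fun i hi ↦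
    (hSR.iteratedFDeriv ℝ i).eq_of_nhds.trans (hO i hi)
  refine ⟨fun q ↦ ψ (q.1, circle 1 q.2),
    hψ.comp (contDiff_fst.prodMk (contDiff_circle.comp (contDiff_const.prodMk contDiff_snd))), ?_⟩
  filter_upwards [eventually_forall_circle hSR] with r hr θ
  rw [← hr, circle_eq_smul, hψS, smul_eq_mul]

theorem polarDivisible_B (k : ℕ) (b : ℕ → ℝ) : PolarDivisible 3 fun x ↦ B k b x.2 := by
  have h : PolarDivisible 3 (∑ i ∈ Finset.Icc 3 k,
      fun x : ℝ × ℝ ↦ b i / (Nat.factorial i : ℝ) * x.2 ^ i) :=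
    .sum fun i hi ↦ .of_homogeneous (Finset.mem_Icc.1 hi).1 (by fun_prop) fun r x ↦ by
      simp only [Prod.smul_snd, smul_eq_mul]; ring
  simpa only [Finset.sum_fn, B] using h

theorem A_smul (a : ℕ → ℕ → ℝ) (j : ℕ) (r u v : ℝ) :
    A a j (r * u) (r * v) = r ^ j * A a j u v := by
  rw [A, A, Finset.mul_sum]
  refine Finset.sum_congr rfl fun i hi ↦ ?_
  rw [← Nat.add_sub_cancel' (Nat.lt_succ_iff.1 (Finset.mem_range.1 hi)), pow_add,
    Nat.add_sub_cancel_left, mul_pow, mul_pow]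
  ring

theorem A_two (a : ℕ → ℕ → ℝ) (u v : ℝ) :
    A a 2 u v = a 2 0 / 2 * u ^ 2 + a 1 1 * u * v + a 0 2 / 2 * v ^ 2 := by
  simp only [A, Nat.reduceAdd, Finset.sum_range_succ, Finset.range_one, Finset.sum_singleton,
    tsub_zero, Nat.factorial_zero, Nat.cast_one, Nat.factorial_two, Nat.cast_ofNat,
    Nat.add_one_sub_one, Nat.factorial_one, tsub_self]
  ring

theorem contDiff_A {n : WithTop ℕ∞} (a : ℕ → ℕ → ℝ) (j : ℕ) :
    ContDiff ℝ n fun x : ℝ × ℝ ↦ A a j x.1 x.2 := by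
  unfold A
  fun_prop

theorem polarDivisible_sum_A {m : ℕ} (k : ℕ) (a : ℕ → ℕ → ℝ) :
    PolarDivisible (m + 1) fun x ↦ ∑ j ∈ Finset.Ioc m k, A a j x.1 x.2 := by
  have h : PolarDivisible (m + 1) (∑ j ∈ Finset.Ioc m k, fun x : ℝ × ℝ ↦ A a j x.1 x.2) :=
    .sum fun j hj ↦ .of_homogeneous (Finset.mem_Ioc.1 hj).1 (contDiff_A a j) fun r x ↦
      A_smul a j r x.1 x.2
  simpa only [Finset.sum_fn] using h

end PolarCoordinates

section PartialDerivatives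

variable {G : Type*} [NormedAddCommGroup G] [NormedSpace ℝ G]

/-- The partial derivative with respect to the radius of a function of `(r, θ)`. -/
def radialDeriv (p : ℝ × ℝ → G) (q : ℝ × ℝ) : G := fderiv ℝ p q (1, 0)

/-- The partial derivative with respect to the angle of a function of `(r, θ)`. -/
def angularDeriv (p : ℝ × ℝ → G) (q : ℝ × ℝ) : G := fderiv ℝ p q (0, 1)

variable {p : ℝ × ℝ → G}

theorem contDiff_radialDeriv (hp : ContDiff ℝ ∞ p) : ContDiff ℝ ∞ (radialDeriv p) :=
  (hp.fderiv_right (by norm_cast)).clm_apply contDiff_const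

theorem contDiff_angularDeriv (hp : ContDiff ℝ ∞ p) : ContDiff ℝ ∞ (angularDeriv p) :=
  (hp.fderiv_right (by norm_cast)).clm_apply contDiff_const

theorem hasDerivAt_radialDeriv {r θ : ℝ} (hp : DifferentiableAt ℝ p (r, θ)) :
    HasDerivAt (fun t ↦ p (t, θ)) (radialDeriv p (r, θ)) r :=
  hp.hasFDerivAt.comp_hasDerivAt r ((hasDerivAt_id r).prodMk (hasDerivAt_const r θ))

theorem hasDerivAt_angularDeriv {r θ : ℝ} (hp : DifferentiableAt ℝ p (r, θ)) :
    HasDerivAt (fun t ↦ p (r, t)) (angularDeriv p (r, θ)) θ :=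
  hp.hasFDerivAt.comp_hasDerivAt θ ((hasDerivAt_const θ r).prodMk (hasDerivAt_id θ))

theorem exists_bound_sub_zero {S : Set (ℝ × ℝ)} (hS : IsOpen S) (hp : ContDiffOn ℝ 1 p S)
    {ε : ℝ} {Θ : Set ℝ} (hΘ : IsCompact Θ) (hsub : Set.Icc (-ε) ε ×ˢ Θ ⊆ S) :
    ∃ C : ℝ, ∀ θ ∈ Θ, ∀ r : ℝ, |r| ≤ ε → ‖p (r, θ) - p (0, θ)‖ ≤ C * |r| := by
  have hcont : ContinuousOn (radialDeriv p) S :=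
    (hp.continuousOn_fderiv_of_isOpen hS le_rfl).clm_apply continuousOn_const
  obtain ⟨C, hC⟩ := (isCompact_Icc.prod hΘ).exists_bound_of_continuousOn (hcont.mono hsub)
  refine ⟨C, fun θ hθ r hr ↦ ?_⟩
  have hderiv (t : ℝ) (ht : t ∈ Set.Icc (-ε) ε) :
      HasDerivWithinAt (fun t ↦ p (t, θ)) (radialDeriv p (t, θ)) (Set.Icc (-ε) ε) t :=
    (hasDerivAt_radialDeriv ((hp.contDiffAt (hS.mem_nhds (hsub ⟨ht, hθ⟩))).differentiableAt
      one_ne_zero)).hasDerivWithinAt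
  have hε : 0 ≤ ε := (abs_nonneg r).trans hr
  simpa using (convex_Icc (-ε) ε).norm_image_sub_le_of_norm_hasDerivWithin_le hderiv
    (fun t ht ↦ hC (t, θ) ⟨ht, hθ⟩) ⟨neg_nonpos.2 hε, hε⟩ (abs_le.1 hr)

end PartialDerivatives

section VectorProduct

theorem hasDerivAt_euclidean {ι : Type*} [Fintype ι] {γ : ℝ → EuclideanSpace ℝ ι}
    {γ' : EuclideanSpace ℝ ι} {t : ℝ} :
    HasDerivAt γ γ' t ↔ ∀ i, HasDerivAt (fun s ↦ γ s i) (γ' i) t := by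
  simp only [← hasDerivWithinAt_univ, hasDerivWithinAt_iff_hasFDerivWithinAt,
    hasFDerivWithinAt_euclidean]
  refine forall_congr' fun i ↦ ?_
  congr!

theorem cross_eq (x y : E3) :
    cross x y = !₂[x 1 * y 2 - x 2 * y 1, x 2 * y 0 - x 0 * y 2, x 0 * y 1 - x 1 * y 0] := by
  rw [cross, cross_apply]

theorem cross_smul_smul (c d : ℝ) (x y : E3) : cross (c • x) (d • y) = (c * d) • cross x y := by
  simp [cross, smul_smul, mul_comm]

theorem inner_cross (x y z : E3) : inner ℝ x (cross y z) = inner ℝ y (cross z x) := by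
  simp only [cross, EuclideanSpace.inner_eq_star_dotProduct]
  simpa [dotProduct_comm] using triple_product_permutation x.ofLp y.ofLp z.ofLp

theorem inner_self_cross (x y : E3) : inner ℝ x (cross x y) = 0 := by
  simp only [cross, EuclideanSpace.inner_eq_star_dotProduct]
  simp [dotProduct_comm]

theorem cross_fderiv (f : ℝ × ℝ → E3) (p v w : ℝ × ℝ) :
    cross (fderiv ℝ f p v) (fderiv ℝ f p w) = (v.1 * w.2 - v.2 * w.1) • normalVector f p := by
  have expand (v : ℝ × ℝ) :
      fderiv ℝ f p v = v.1 • fderiv ℝ f p (1, 0) + v.2 • fderiv ℝ f p (0, 1) := by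
    rw [← map_smul, ← map_smul, ← map_add]
    simp
  rw [expand v, expand w, normalVector, cross_eq, cross_eq]
  ext i
  fin_cases i <;> simp <;> ring

theorem geodesicCurvature_eq (f : ℝ × ℝ → E3) (γ : ℝ → ℝ × ℝ) (t : ℝ) :
    geodesicCurvature f γ t =
      inner ℝ (normalVector f (γ t)) (cross (deriv (f ∘ γ) t) (deriv (deriv (f ∘ γ)) t)) /
        (‖normalVector f (γ t)‖ * ‖deriv (f ∘ γ) t‖ ^ 3) := by
  rw [inner_cross, inner_cross]
  simp only [geodesicCurvature, geodesicCurvatureVector, covariantAcceleration, unitNormal,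
    cross_smul_smul, real_inner_smul_left, real_inner_smul_right, inner_sub_left, inner_self_cross]
  simp only [mul_zero, sub_zero, div_eq_mul_inv, mul_inv]
  ring

theorem contDiff_cross {X : Type*} [NormedAddCommGroup X] [NormedSpace ℝ X] {n : WithTop ℕ∞}
    {x y : X → E3} (hx : ContDiff ℝ n x) (hy : ContDiff ℝ n y) :
    ContDiff ℝ n fun q ↦ cross (x q) (y q) := by
  have hx' := contDiff_euclidean.1 hx
  have hy' := contDiff_euclidean.1 hy
  refine contDiff_euclidean.2 fun i ↦ ?_
  simp only [cross_eq]
  fin_cases i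
  exacts [((hx' 1).mul (hy' 2)).sub ((hx' 2).mul (hy' 1)),
    ((hx' 2).mul (hy' 0)).sub ((hx' 0).mul (hy' 2)),
    ((hx' 0).mul (hy' 1)).sub ((hx' 1).mul (hy' 0))]

end VectorProduct

section PolarForm

/-- The linear map `diag(1, r, r)`. -/
def dilation (r : ℝ) (x : E3) : E3 := !₂[x 0, r * x 1, r * x 2]

/-- The linear map `diag(r, 1, 1)`: up to the factor `r`, the effect of `dilation r` on vector
products. -/
def codilation (r : ℝ) (x : E3) : E3 := !₂[r * x 0, x 1, x 2]

theorem cross_dilation (r : ℝ) (x y : E3) :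
    cross (dilation r x) (dilation r y) = r • codilation r (cross x y) := by
  simp only [cross_eq, dilation, codilation]
  ext i
  fin_cases i <;> simp <;> ring

theorem contDiff_dilation {X : Type*} [NormedAddCommGroup X] [NormedSpace ℝ X] {n : WithTop ℕ∞}
    {ρ : X → ℝ} {x : X → E3} (hρ : ContDiff ℝ n ρ) (hx : ContDiff ℝ n x) :
    ContDiff ℝ n fun q ↦ dilation (ρ q) (x q) := by
  have hx' := contDiff_euclidean.1 hx
  refine contDiff_euclidean.2 fun i ↦ ?_
  fin_cases i
  exacts [hx' 0, hρ.mul (hx' 1), hρ.mul (hx' 2)]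

theorem contDiff_codilation {X : Type*} [NormedAddCommGroup X] [NormedSpace ℝ X]
    {n : WithTop ℕ∞} {ρ : X → ℝ} {x : X → E3} (hρ : ContDiff ℝ n ρ) (hx : ContDiff ℝ n x) :
    ContDiff ℝ n fun q ↦ codilation (ρ q) (x q) := by
  have hx' := contDiff_euclidean.1 hx
  refine contDiff_euclidean.2 fun i ↦ ?_
  fin_cases i
  exacts [hρ.mul (hx' 0), hx' 1, hx' 2]

/-- The radial derivative of `r • dilation r (p (r, θ))`, up to `dilation r`. -/
def eulerDeriv (p : ℝ × ℝ → E3) (q : ℝ × ℝ) : E3 := dilation 2 (p q) + q.1 • radialDeriv p q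

/-- The vector `f_u × f_v` at `circle r θ` divided by `r`, for `f` with polar form `p`. -/
def polarNormal (p : ℝ × ℝ → E3) (q : ℝ × ℝ) : E3 :=
  codilation q.1 (cross (eulerDeriv p q) (angularDeriv p q))

/-- The velocity of `f ∘ circle r` divided by `r`, for `f` with polar form `p`. -/
def polarVelocity (p : ℝ × ℝ → E3) (q : ℝ × ℝ) : E3 := dilation q.1 (angularDeriv p q)

/-- The geodesic curvature of `f ∘ circle r`, for `f` with polar form `p`, after cancellation of
all powers of `r`. -/
def polarCurvature (p : ℝ × ℝ → E3) (q : ℝ × ℝ) : ℝ :=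
  inner ℝ (polarNormal p q)
      (codilation q.1 (cross (angularDeriv p q) (angularDeriv (angularDeriv p) q))) /
    (‖polarNormal p q‖ * ‖polarVelocity p q‖ ^ 3)

theorem contDiff_polarNormal {p : ℝ × ℝ → E3} (hp : ContDiff ℝ ∞ p) :
    ContDiff ℝ ∞ (polarNormal p) :=
  contDiff_codilation contDiff_fst <| contDiff_cross
    ((contDiff_dilation contDiff_const hp).add (contDiff_fst.smul (contDiff_radialDeriv hp)))
    (contDiff_angularDeriv hp)

theorem contDiffAt_polarCurvature {p : ℝ × ℝ → E3} (hp : ContDiff ℝ ∞ p) {q : ℝ × ℝ}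
    (hN : polarNormal p q ≠ 0) (hv : polarVelocity p q ≠ 0) :
    ContDiffAt ℝ ∞ (polarCurvature p) q := by
  have hθ := contDiff_angularDeriv hp
  have hnormal := (contDiff_polarNormal hp).contDiffAt (x := q)
  have hvelocity := (contDiff_dilation contDiff_fst hθ).contDiffAt (x := q)
  have hbinormal := (contDiff_codilation contDiff_fst
    (contDiff_cross hθ (contDiff_angularDeriv hθ))).contDiffAt (x := q)
  exact (hnormal.inner ℝ hbinormal).div ((hnormal.norm ℝ hN).mul ((hvelocity.norm ℝ hv).pow 3))
    (mul_ne_zero (norm_ne_zero_iff.2 hN) (pow_ne_zero 3 (norm_ne_zero_iff.2 hv)))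

/-- `p` is a polar form of the surface `f` on the disc of radius `δ`:
`f(r cos θ, r sin θ) = (r cos θ, r² p₁(r, θ), r² p₂(r, θ))`. -/
structure IsPolarForm (f : ℝ × ℝ → E3) (p : ℝ × ℝ → E3) (δ : ℝ) : Prop where
  contDiff : ContDiff ℝ ∞ p
  apply_zero : ∀ q, p q 0 = Real.cos q.2
  differentiableAt : ∀ r θ, |r| < δ → DifferentiableAt ℝ f (circle r θ)
  eq_smul_dilation : ∀ r θ, |r| < δ → f (circle r θ) = r • dilation r (p (r, θ))

variable {f : ℝ × ℝ → E3} {p : ℝ × ℝ → E3} {δ r : ℝ}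

theorem hasDerivAt_smul_dilation {γ : ℝ → E3} {γ' : E3} {t : ℝ} (r : ℝ) (hγ : HasDerivAt γ γ' t) :
    HasDerivAt (fun t ↦ r • dilation r (γ t)) (r • dilation r γ') t := by
  refine .const_smul r <| hasDerivAt_euclidean.2 fun i ↦ ?_
  have h := hasDerivAt_euclidean.1 hγ i
  fin_cases i
  exacts [h, h.const_mul r, h.const_mul r]

theorem IsPolarForm.hasDerivAt (h : IsPolarForm f p δ) (hr : |r| < δ) (θ : ℝ) :
    HasDerivAt (f ∘ circle r) (r • polarVelocity p (r, θ)) θ := by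
  rw [show f ∘ circle r = fun θ ↦ r • dilation r (p (r, θ)) from
    funext fun θ ↦ h.eq_smul_dilation r θ hr]
  exact hasDerivAt_smul_dilation r
    (hasDerivAt_angularDeriv (h.contDiff.differentiable (by simp) (r, θ)))

theorem IsPolarForm.deriv_deriv (h : IsPolarForm f p δ) (hr : |r| < δ) (θ : ℝ) :
    deriv (deriv (f ∘ circle r)) θ =
      r • dilation r (angularDeriv (angularDeriv p) (r, θ)) := by
  rw [funext fun θ ↦ (h.hasDerivAt hr θ).deriv]
  exact (hasDerivAt_smul_dilation r (hasDerivAt_angularDeriv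
    ((contDiff_angularDeriv h.contDiff).differentiable (by simp) (r, θ)))).deriv

theorem IsPolarForm.hasDerivAt_radial (h : IsPolarForm f p δ) (hr : |r| < δ) (θ : ℝ) :
    HasDerivAt (fun t ↦ f (circle t θ)) (dilation r (eulerDeriv p (r, θ))) r := by
  have heq : (fun t ↦ f (circle t θ)) =ᶠ[𝓝 r] fun t ↦ t • dilation t (p (t, θ)) := by
    filter_upwards [continuous_abs.continuousAt.eventually_lt continuousAt_const hr] with t ht
    exact h.eq_smul_dilation t θ ht
  have hp := hasDerivAt_euclidean.1
    (hasDerivAt_radialDeriv (h.contDiff.differentiable (by simp) (r, θ)))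
  refine (hasDerivAt_euclidean.2 fun i ↦ ?_).congr_of_eventuallyEq heq
  have hid := hasDerivAt_id r
  fin_cases i
  · exact (hid.mul (hp 0)).congr_deriv (by simp [eulerDeriv, dilation])
  · exact (hid.mul (hid.mul (hp 1))).congr_deriv (by simp [eulerDeriv, dilation]; ring)
  · exact (hid.mul (hid.mul (hp 2))).congr_deriv (by simp [eulerDeriv, dilation]; ring)

theorem IsPolarForm.normalVector_circle (h : IsPolarForm f p δ) (hr0 : r ≠ 0) (hr : |r| < δ)
    (θ : ℝ) : normalVector f (circle r θ) = r • polarNormal p (r, θ) := by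
  have hf := (h.differentiableAt r θ hr).hasFDerivAt
  have hradial : HasDerivAt (fun t ↦ circle t θ) (Real.cos θ, Real.sin θ) r :=
    (hasDerivAt_mul_const _).prodMk (hasDerivAt_mul_const _)
  have hangular : HasDerivAt (circle r) (r * -Real.sin θ, r * Real.cos θ) θ :=
    ((Real.hasDerivAt_cos θ).const_mul r).prodMk ((Real.hasDerivAt_sin θ).const_mul r)
  have hu := (hf.comp_hasDerivAt r hradial).unique (h.hasDerivAt_radial hr θ)
  have hv := (hf.comp_hasDerivAt θ hangular).unique (h.hasDerivAt hr θ)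
  have hcross := cross_fderiv f (circle r θ) (Real.cos θ, Real.sin θ)
    (r * -Real.sin θ, r * Real.cos θ)
  have hdet : Real.cos θ * (r * Real.cos θ) - Real.sin θ * (r * -Real.sin θ) = r := by
    linear_combination r * Real.cos_sq_add_sin_sq θ
  rw [hu, hv, hdet, polarVelocity, ← one_smul ℝ (dilation r (eulerDeriv p (r, θ))),
    cross_smul_smul, one_mul, cross_dilation] at hcross
  exact (smul_right_injective E3 hr0 hcross).symm

theorem IsPolarForm.kappaG_eq (h : IsPolarForm f p δ) (hr0 : r ≠ 0) (hr : |r| < δ)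
    (θ : ℝ) : kappaG f r θ = polarCurvature p (r, θ) := by
  have hr4 : ‖r‖ ^ 4 = r ^ 4 := Even.pow_abs ⟨2, rfl⟩ r
  rw [kappaG, geodesicCurvature_eq, h.normalVector_circle hr0 hr, (h.hasDerivAt hr θ).deriv,
    h.deriv_deriv hr]
  refine Eq.trans ?_ (mul_div_mul_left _ _ (pow_ne_zero 4 hr0))
  simp only [polarVelocity, cross_smul_smul, cross_dilation, norm_smul, real_inner_smul_left,
    real_inner_smul_right]
  congr 1
  · ring
  · linear_combination
      ‖polarNormal p (r, θ)‖ * ‖dilation r (angularDeriv p (r, θ))‖ ^ 3 * hr4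

theorem IsPolarForm.polarVelocity_ne_zero (h : IsPolarForm f p δ) {q : ℝ × ℝ}
    (hq : Real.sin q.2 ≠ 0) : polarVelocity p q ≠ 0 := by
  have hcos := hasDerivAt_euclidean.1
    (hasDerivAt_angularDeriv (h.contDiff.differentiable (by simp) q)) 0
  simp only [h.apply_zero] at hcos
  have hsin : polarVelocity p q 0 = -Real.sin q.2 := hcos.unique (Real.hasDerivAt_cos q.2)
  exact fun h0 ↦ hq (by simpa [h0] using hsin)

theorem IsPolarForm.eventually_polarNormal_ne_zero (h : IsPolarForm f p δ) (hδ : 0 < δ)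
    (h0 : ∀ θ, polarNormal p (0, θ) ≠ 0) : ∀ᶠ r in 𝓝 0, ∀ θ, polarNormal p (r, θ) ≠ 0 := by
  have hcont := (contDiff_polarNormal h.contDiff).continuous
  have hperiod : ∀ᶠ r in 𝓝 0, ∀ θ ∈ Set.Icc 0 (2 * Real.pi), polarNormal p (r, θ) ≠ 0 :=
    isCompact_Icc.eventually_forall_of_forall_eventually fun θ _ ↦
      hcont.continuousAt.eventually_ne (h0 θ)
  filter_upwards [hperiod, eventually_abs_sub_lt 0 hδ] with r hperiod hr θ
  rw [sub_zero] at hr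
  rcases eq_or_ne r 0 with rfl | hr0
  · exact h0 θ
  -- The normal vector, unlike `polarNormal p (r, θ)`, is manifestly periodic in `θ`.
  have hcircle : Function.Periodic (circle r) (2 * Real.pi) := fun θ ↦ by simp [circle]
  obtain ⟨θ', hθ', heq⟩ := hcircle.exists_mem_Ico₀ Real.two_pi_pos θ
  have hnormal := congrArg (normalVector f) heq
  rw [h.normalVector_circle hr0 hr, h.normalVector_circle hr0 hr] at hnormal
  rw [smul_right_injective E3 hr0 hnormal]
  exact hperiod θ' (Set.Ico_subset_Icc_self hθ')

theorem IsPolarForm.contDiffOn_polarCurvature (h : IsPolarForm f p δ) :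
    ContDiffOn ℝ ∞ (polarCurvature p) {q | polarNormal p q ≠ 0 ∧ Real.sin q.2 ≠ 0} := fun _ hq ↦
  (contDiffAt_polarCurvature h.contDiff hq.1 (h.polarVelocity_ne_zero hq.2)).contDiffWithinAt

theorem IsPolarForm.exists_bound_kappaG_sub (h : IsPolarForm f p δ) {ε : ℝ} (hεδ : ε < δ)
    (hN : ∀ r θ, |r| ≤ ε → polarNormal p (r, θ) ≠ 0) {Θ : Set ℝ} (hΘ : IsCompact Θ)
    (hsin : ∀ θ ∈ Θ, Real.sin θ ≠ 0) :
    ∃ C : ℝ, ∀ θ ∈ Θ, ∀ r : ℝ, r ≠ 0 → |r| ≤ ε →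
      |kappaG f r θ - polarCurvature p (0, θ)| ≤ C * |r| := by
  have hopen : IsOpen {q : ℝ × ℝ | polarNormal p q ≠ 0 ∧ Real.sin q.2 ≠ 0} :=
    (isOpen_ne_fun (contDiff_polarNormal h.contDiff).continuous continuous_const).inter
      (isOpen_ne_fun (by fun_prop) continuous_const)
  obtain ⟨C, hC⟩ := exists_bound_sub_zero hopen (h.contDiffOn_polarCurvature.of_le (by simp)) hΘ
    (ε := ε) fun q hq ↦ ⟨hN q.1 q.2 (abs_le.2 hq.1), hsin q.2 hq.2⟩
  refine ⟨C, fun θ hθ r hr0 hr ↦ ?_⟩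
  rw [h.kappaG_eq hr0 (hr.trans_lt hεδ)]
  exact hC θ hθ r hr

end PolarForm

section NormalForm

/-- The value at `r = 0` of the polar form of a Whitney umbrella: the coefficients of its quadratic
part on the unit circle. -/
def initialProfile (a₂₀ a₁₁ a₀₂ θ : ℝ) : E3 :=
  !₂[Real.cos θ, Real.cos θ * Real.sin θ,
    a₂₀ / 2 * Real.cos θ ^ 2 + a₁₁ * (Real.cos θ * Real.sin θ) + a₀₂ / 2 * Real.sin θ ^ 2]

theorem contDiff_initialProfile {n : WithTop ℕ∞} (a₂₀ a₁₁ a₀₂ : ℝ) :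
    ContDiff ℝ n (initialProfile a₂₀ a₁₁ a₀₂) := by
  refine contDiff_euclidean.2 fun i ↦ ?_
  fin_cases i <;> simp only [initialProfile, Fin.zero_eta, Fin.mk_one, Fin.reduceFinMk,
    Matrix.cons_val] <;> fun_prop

theorem differentiableAt_normalForm (k : ℕ) (b : ℕ → ℝ) (a : ℕ → ℕ → ℝ) {R₂ R₃ : ℝ × ℝ → ℝ}
    {x : ℝ × ℝ} (h₂ : DifferentiableAt ℝ R₂ x) (h₃ : DifferentiableAt ℝ R₃ x) :
    DifferentiableAt ℝ (normalForm k b a R₂ R₃) x := by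
  refine differentiableAt_euclidean.2 fun i ↦ ?_
  fin_cases i <;> simp only [normalForm, B, A, Fin.zero_eta, Fin.mk_one, Fin.reduceFinMk,
    Matrix.cons_val] <;> fun_prop

theorem exists_isPolarForm {k : ℕ} (hk : 2 ≤ k) (b : ℕ → ℝ) (a : ℕ → ℕ → ℝ) {W : Set (ℝ × ℝ)}
    (hW : W ∈ 𝓝 0) {R₂ R₃ : ℝ × ℝ → ℝ} (hR₂ : ∀ x ∈ W, ContDiffAt ℝ ∞ R₂ x)
    (hR₃ : ∀ x ∈ W, ContDiffAt ℝ ∞ R₃ x) (hO₂ : HasOrderGE R₂ 3) (hO₃ : HasOrderGE R₃ 3) :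
    ∃ p : ℝ × ℝ → E3, ∃ δ > 0, IsPolarForm (normalForm k b a R₂ R₃) p δ ∧
      ∀ θ, p (0, θ) = initialProfile (a 2 0) (a 1 1) (a 0 2) θ := by
  obtain ⟨ψ₂, hψ₂, h₂⟩ := (polarDivisible_B k b).add (hO₂.polarDivisible hW hR₂)
  obtain ⟨ψ₃, hψ₃, h₃⟩ := (polarDivisible_sum_A (m := 2) k a).add (hO₃.polarDivisible hW hR₃)
  obtain ⟨δ, hδ, h⟩ := Metric.eventually_nhds_iff.1 ((eventually_forall_circle hW).and (h₂.and h₃))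
  replace h (r : ℝ) (hr : |r| < δ) := h (by simpa using hr)
  refine ⟨fun q ↦ initialProfile (a 2 0) (a 1 1) (a 0 2) q.2 + q.1 • !₂[0, ψ₂ q, ψ₃ q], δ, hδ,
    ⟨?_, fun q ↦ by simp [initialProfile], fun r θ hr ↦ ?_, fun r θ hr ↦ ?_⟩, fun θ ↦ by simp⟩
  · refine ((contDiff_initialProfile _ _ _).comp contDiff_snd).add
      (contDiff_fst.smul (contDiff_euclidean.2 fun i ↦ ?_))
    fin_cases i
    exacts [contDiff_const, hψ₂, hψ₃]
  · have hmem := (h r hr).1 θ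
    exact differentiableAt_normalForm k b a ((hR₂ _ hmem).differentiableAt (by simp))
      ((hR₃ _ hmem).differentiableAt (by simp))
  · have h₂ := (h r hr).2.1 θ
    have h₃ := (h r hr).2.2 θ
    simp only [Pi.add_apply, circle] at h₂ h₃
    ext i
    fin_cases i
    · simp [normalForm, initialProfile, dilation, circle]
    · simp only [normalForm, circle, dilation, initialProfile, Fin.mk_one, Matrix.cons_val,
        PiLp.add_apply, PiLp.smul_apply, smul_eq_mul]
      linear_combination h₂
    · simp only [normalForm, circle, dilation, initialProfile, Fin.reduceFinMk, Matrix.cons_val,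
        PiLp.add_apply, PiLp.smul_apply, smul_eq_mul]
      rw [← Finset.add_sum_Ioc_eq_sum_Icc hk, A_two]
      linear_combination h₃

theorem hasDerivAt_cos_mul_sin (θ : ℝ) :
    HasDerivAt (fun θ ↦ Real.cos θ * Real.sin θ) (Real.cos θ ^ 2 - Real.sin θ ^ 2) θ :=
  ((Real.hasDerivAt_cos θ).mul (Real.hasDerivAt_sin θ)).congr_deriv (by ring)

theorem hasDerivAt_cos_sq_sub_sin_sq (θ : ℝ) :
    HasDerivAt (fun θ ↦ Real.cos θ ^ 2 - Real.sin θ ^ 2) (-4 * (Real.cos θ * Real.sin θ)) θ :=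
  (((Real.hasDerivAt_cos θ).pow 2).sub ((Real.hasDerivAt_sin θ).pow 2)).congr_deriv (by ring)

section InitialValues

variable {p : ℝ × ℝ → E3} {a₂₀ a₁₁ a₀₂ : ℝ} (hp : ContDiff ℝ ∞ p)
  (h0 : ∀ θ, p (0, θ) = initialProfile a₂₀ a₁₁ a₀₂ θ)
include hp h0

theorem angularDeriv_initial (θ : ℝ) :
    angularDeriv p (0, θ) = !₂[-Real.sin θ, Real.cos θ ^ 2 - Real.sin θ ^ 2,
      a₁₁ * (Real.cos θ ^ 2 - Real.sin θ ^ 2) + (a₀₂ - a₂₀) * (Real.cos θ * Real.sin θ)] := by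
  have h := hasDerivAt_angularDeriv (hp.differentiable (by simp) (0, θ))
  rw [funext h0] at h
  have hcos := Real.hasDerivAt_cos θ
  refine h.unique (hasDerivAt_euclidean.2 fun i ↦ ?_)
  fin_cases i
  · exact hcos
  · exact hasDerivAt_cos_mul_sin θ
  · exact ((((hcos.pow 2).const_mul _).add ((hasDerivAt_cos_mul_sin θ).const_mul _)).add
      (((Real.hasDerivAt_sin θ).pow 2).const_mul _)).congr_deriv (by simp; ring)

theorem angularDeriv_angularDeriv_initial (θ : ℝ) :
    angularDeriv (angularDeriv p) (0, θ) = !₂[-Real.cos θ, -4 * (Real.cos θ * Real.sin θ),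
      a₁₁ * (-4 * (Real.cos θ * Real.sin θ)) +
        (a₀₂ - a₂₀) * (Real.cos θ ^ 2 - Real.sin θ ^ 2)] := by
  have h := hasDerivAt_angularDeriv ((contDiff_angularDeriv hp).differentiable (by simp) (0, θ))
  rw [funext (angularDeriv_initial hp h0)] at h
  refine h.unique (hasDerivAt_euclidean.2 fun i ↦ ?_)
  fin_cases i
  · exact (Real.hasDerivAt_sin θ).neg
  · exact hasDerivAt_cos_sq_sub_sin_sq θ
  · exact ((hasDerivAt_cos_sq_sub_sin_sq θ).const_mul _).add
      ((hasDerivAt_cos_mul_sin θ).const_mul _)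

theorem polarNormal_initial (θ : ℝ) :
    polarNormal p (0, θ) = !₂[0, -(a₁₁ * Real.cos θ + a₀₂ * Real.sin θ), Real.cos θ] := by
  have hcs := Real.cos_sq_add_sin_sq θ
  simp only [polarNormal, eulerDeriv, h0, angularDeriv_initial hp h0, zero_smul, add_zero,
    cross_eq, codilation, dilation, initialProfile]
  ext i
  fin_cases i <;> simp only [Fin.zero_eta, Fin.mk_one, Fin.reduceFinMk, Matrix.cons_val]
  · ring
  · linear_combination -(a₁₁ * Real.cos θ + a₀₂ * Real.sin θ) * hcs
  · linear_combination Real.cos θ * hcs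

theorem polarNormal_initial_ne_zero (ha : a₀₂ ≠ 0) (θ : ℝ) : polarNormal p (0, θ) ≠ 0 := by
  intro hN
  rw [polarNormal_initial hp h0] at hN
  have hcos : Real.cos θ = 0 := by simpa using congrArg (· 2) hN
  have hsin : Real.sin θ = 0 := by simpa [hcos, ha] using congrArg (· 1) hN
  simpa [hcos, hsin] using Real.cos_sq_add_sin_sq θ

theorem norm_polarNormal_initial (θ : ℝ) : ‖polarNormal p (0, θ)‖ = calA a₁₁ a₀₂ θ := by
  rw [polarNormal_initial hp h0, EuclideanSpace.norm_eq, calA, Fin.sum_univ_three]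
  congr 1
  simp only [Matrix.cons_val, Real.norm_eq_abs, sq_abs]
  ring

theorem norm_polarVelocity_initial (θ : ℝ) : ‖polarVelocity p (0, θ)‖ = |Real.sin θ| := by
  simp [polarVelocity, angularDeriv_initial hp h0, dilation, EuclideanSpace.norm_eq,
    Fin.sum_univ_three, Real.sqrt_sq_eq_abs]

theorem polarCurvature_initial {θ : ℝ} (hθ : Real.sin θ ≠ 0) :
    polarCurvature p (0, θ) = leadingTerm a₂₀ a₁₁ a₀₂ θ := by
  have htriple : inner ℝ (polarNormal p (0, θ)) (codilation 0 (cross (angularDeriv p (0, θ))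
      (angularDeriv (angularDeriv p) (0, θ)))) =
      |Real.sin θ| ^ 4 * g a₂₀ a₁₁ a₀₂ (Real.cos θ / Real.sin θ) := by
    rw [polarNormal_initial hp h0, angularDeriv_initial hp h0,
      angularDeriv_angularDeriv_initial hp h0, Even.pow_abs ⟨2, rfl⟩, g]
    simp only [cross_eq, codilation, PiLp.inner_apply, RCLike.inner_apply, Real.ringHom_apply,
      Fin.sum_univ_three, Matrix.cons_val]
    field_simp
    ring
  have habs : |Real.sin θ| ≠ 0 := abs_ne_zero.2 hθ
  rw [polarCurvature, htriple, norm_polarNormal_initial hp h0, norm_polarVelocity_initial hp h0,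
    leadingTerm]
  field_simp

end InitialValues

end NormalForm

end WhitneyUmbrella

end

open WhitneyUmbrella Topology in
theorem theorem3p2_general (k : ℕ) (hk : 2 ≤ k) (b : ℕ → ℝ) (a : ℕ → ℕ → ℝ) (ha : a 0 2 ≠ 0)
    (W : Set (ℝ × ℝ)) (hW : IsOpen W) (h0 : (0 : ℝ × ℝ) ∈ W) (R₂ R₃ : ℝ × ℝ → ℝ)
    (hR₂ : ContDiffOn ℝ ∞ R₂ W) (hR₃ : ContDiffOn ℝ ∞ R₃ W)
    (hO₂ : HasOrderGE R₂ 3) (hO₃ : HasOrderGE R₃ 3) :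
    ∃ ε : ℝ, 0 < ε ∧
      (∀ r θ : ℝ, 0 < |r| → |r| < ε →
        circle r θ ∈ W ∧ normalVector (normalForm k b a R₂ R₃) (circle r θ) ≠ 0 ∧
        (Real.sin θ ≠ 0 → deriv (normalForm k b a R₂ R₃ ∘ circle r) θ ≠ 0)) ∧
      (∃ K : ℝ × ℝ → ℝ,
        ContDiffOn ℝ ∞ K {q | |q.1| < ε ∧ Real.sin q.2 ≠ 0} ∧
        (∀ r θ : ℝ, 0 < |r| → |r| < ε → Real.sin θ ≠ 0 →
          K (r, θ) = kappaG (normalForm k b a R₂ R₃) r θ) ∧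
        (∀ θ : ℝ, Real.sin θ ≠ 0 → K (0, θ) = leadingTerm (a 2 0) (a 1 1) (a 0 2) θ)) ∧
      (∀ Θ : Set ℝ, IsCompact Θ → (∀ θ ∈ Θ, Real.sin θ ≠ 0) →
        ∃ C : ℝ, ∀ θ ∈ Θ, ∀ r : ℝ, 0 < |r| → |r| < ε →
          |kappaG (normalForm k b a R₂ R₃) r θ
            - leadingTerm (a 2 0) (a 1 1) (a 0 2) θ| ≤ C * |r|) := by
  obtain ⟨p, δ, hδ, hp, hp0⟩ := exists_isPolarForm hk b a (hW.mem_nhds h0)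
    (fun x hx ↦ hR₂.contDiffAt (hW.mem_nhds hx)) (fun x hx ↦ hR₃.contDiffAt (hW.mem_nhds hx))
    hO₂ hO₃
  have hκ0 {θ : ℝ} (hθ : Real.sin θ ≠ 0) := polarCurvature_initial hp.contDiff hp0 hθ
  have hsmall : ∀ᶠ r in 𝓝 0, |r| < δ ∧ ∀ θ, circle r θ ∈ W ∧ polarNormal p (r, θ) ≠ 0 := by
    filter_upwards [eventually_abs_sub_lt 0 hδ, eventually_forall_circle (hW.mem_nhds h0),
      hp.eventually_polarNormal_ne_zero hδ (polarNormal_initial_ne_zero hp.contDiff hp0 ha)]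
      with r hr hrW hN using ⟨by simpa using hr, fun θ ↦ ⟨hrW θ, hN θ⟩⟩
  obtain ⟨ε, hε, hgood⟩ := Metric.nhds_basis_closedBall.eventually_iff.1 hsmall
  replace hgood {r : ℝ} (hr : |r| ≤ ε) := hgood (mem_closedBall_zero_iff.2 hr)
  have hεδ : ε < δ := (le_abs_self ε).trans_lt (hgood (abs_of_pos hε).le).1
  refine ⟨ε, hε, fun r θ hr0 hr ↦ ⟨((hgood hr.le).2 θ).1, ?_, fun hθ ↦ ?_⟩,
    ⟨polarCurvature p, hp.contDiffOn_polarCurvature.mono fun q hq ↦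
      ⟨((hgood hq.1.le).2 q.2).2, hq.2⟩, fun r θ hr0 hr _ ↦
      (hp.kappaG_eq (abs_pos.1 hr0) (hr.trans hεδ) θ).symm, fun θ ↦ hκ0⟩, fun Θ hΘ hsin ↦ ?_⟩
  · rw [hp.normalVector_circle (abs_pos.1 hr0) (hr.trans hεδ)]
    exact smul_ne_zero (abs_pos.1 hr0) ((hgood hr.le).2 θ).2
  · rw [(hp.hasDerivAt (hr.trans hεδ) θ).deriv]
    exact smul_ne_zero (abs_pos.1 hr0) (hp.polarVelocity_ne_zero hθ)
  · obtain ⟨C, hC⟩ := hp.exists_bound_kappaG_sub hεδ (fun r θ hr ↦ ((hgood hr).2 θ).2) hΘ hsin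
    exact ⟨C, fun θ hθ r hr0 hr ↦ hκ0 (hsin θ hθ) ▸ hC θ hθ r (abs_pos.1 hr0) hr.le⟩

theorem theorem3p2 (k : ℕ) (hk : 3 ≤ k) (b : ℕ → ℝ) (a : ℕ → ℕ → ℝ) (ha : 0 < a 0 2)
    (W : Set (ℝ × ℝ)) (hW : IsOpen W) (h0 : (0 : ℝ × ℝ) ∈ W)
    (R₂ R₃ : ℝ × ℝ → ℝ)
    (hR₂ : ContDiffOn ℝ ∞ R₂ W) (hR₃ : ContDiffOn ℝ ∞ R₃ W)
    (hO₂ : WhitneyUmbrella.HasOrderGE R₂ (k + 1))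
    (hO₃ : WhitneyUmbrella.HasOrderGE R₃ (k + 1)) :
    ∃ ε : ℝ, 0 < ε ∧
      -- for `0 < |r| < ε` and `sin θ ≠ 0` the geodesic curvature is well defined:
      -- the circle lies in the domain, where `f₀` is immersive, and its image is regular
      (∀ r θ : ℝ, 0 < |r| → |r| < ε →
        WhitneyUmbrella.circle r θ ∈ W ∧
        WhitneyUmbrella.normalVector (WhitneyUmbrella.normalForm k b a R₂ R₃)
          (WhitneyUmbrella.circle r θ) ≠ 0 ∧
        (Real.sin θ ≠ 0 →
          deriv (WhitneyUmbrella.normalForm k b a R₂ R₃ ∘ WhitneyUmbrella.circle r) θ ≠ 0)) ∧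
      -- it is a smooth function of `(r, θ)`, up to and including `r = 0`
      (∃ K : ℝ × ℝ → ℝ,
        ContDiffOn ℝ ∞ K {q | |q.1| < ε ∧ Real.sin q.2 ≠ 0} ∧
        (∀ r θ : ℝ, 0 < |r| → |r| < ε → Real.sin θ ≠ 0 →
          K (r, θ) = WhitneyUmbrella.kappaG (WhitneyUmbrella.normalForm k b a R₂ R₃) r θ) ∧
        (∀ θ : ℝ, Real.sin θ ≠ 0 →
          K (0, θ) = WhitneyUmbrella.leadingTerm (a 2 0) (a 1 1) (a 0 2) θ)) ∧
      -- the expansion, with error `O(r)` uniformly for `θ` in compact subsets of `sin θ ≠ 0`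
      (∀ Θ : Set ℝ, IsCompact Θ → (∀ θ ∈ Θ, Real.sin θ ≠ 0) →
        ∃ C : ℝ, ∀ θ ∈ Θ, ∀ r : ℝ, 0 < |r| → |r| < ε →
          |WhitneyUmbrella.kappaG (WhitneyUmbrella.normalForm k b a R₂ R₃) r θ
            - WhitneyUmbrella.leadingTerm (a 2 0) (a 1 1) (a 0 2) θ| ≤ C * |r|) :=
  theorem3p2_general k (by omega) b a ha.ne' W hW h0 R₂ R₃ hR₂ hR₃
    (fun i hi ↦ hO₂ i (by omega)) (fun i hi ↦ hO₃ i (by omega))
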